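/- All lattices are finite. An \emph{MI-ordering} of an antichain $\mathcal{A}$ in a lattice $L$ is a listing $a_1,a_2,\ldots,a_t$ of the elements of $\mathcal{A}$, each exactly once, such that (i) $a_i\lor a_{i+1}\lor\cdots\lor a_k=a_i\lor a_k$ for $1\le i<k\le t$, and (ii) $(a_1\land a_2\land\cdots\land a_k)\lor a_{k+1}=a_k\lor a_{k+1}$ for $1<k<t$. A lattice is \emph{MI-orderable} if each of its antichains has an MI-ordering. A flat $X$ of a matroid $M$ is \emph{cyclic} if the restriction $M|X$ has no isthmuses (coloops); the cyclic flats of $M$, ordered by inclusion, form a lattice $\mathcal{Z}(M)$. A lattice $L$ is a \emph{Tr-lattice} if every matroid $M$ on a finite ground set with $\mathcal{Z}(M)\cong L$ is transversal. Let $D^d$, $F_0$ and $C$ be the following nine-element lattices, given by their covering relations, where $x\prec y$ means that $y$ covers $x$. $D^d$, on $\{z,p,q,a,m,c,s,b,e\}$: $z\prec p$, $z\prec q$, $p\prec a$, $p\prec m$, $q\prec m$, $q\prec c$, $a\prec s$, $m\prec s$, $c\prec s$, $m\prec b$, $s\prec e$, $b\prec e$. $F_0$, on $\{Z,D,U,T,X,A,S,R,E\}$: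 $Z\prec D$, $Z\prec U$, $U\prec X$, $U\prec T$, $T\prec A$, $T\prec S$, $D\prec S$, $S\prec R$, $X\prec R$, $R\prec E$, $A\prec E$. $C$, on $\{Z,T,Y,V,W,A,S,B,E\}$: $Z\prec T$, $Z\prec Y$, $T\prec V$, $T\prec W$, $V\prec A$, $V\prec S$, $W\prec S$, $W\prec B$, $Y\prec S$, $A\prec E$, $S\prec E$, $B\prec E$. \textbf{Theorem.} The lattice $D^d$ is MI-orderable. The lattices $F_0$ and $C$ are Tr-lattices that are not MI-orderable. -/

import Mathlib

universe u v

/-- A cyclic flat of `M`: a flat `X` such that the restriction of `M` to `X` has no coloops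
(isthmuses). -/
def Matroid.IsCyclicFlat {α : Type*} (M : Matroid α) (X : Set α) : Prop :=
  M.IsFlat X ∧ ∀ e, ¬ (M.restrict X).IsColoop e

/-- The cyclic flats of `M`, ordered by inclusion. -/
abbrev Matroid.CyclicFlats {α : Type*} (M : Matroid α) : Type _ :=
  {X : Set α // M.IsCyclicFlat X}

/-- `M` is transversal: for some finite family `A` of subsets of the ground set, the independent
sets of `M` are exactly the partial transversals of `A`. -/
def Matroid.IsTransversal {α : Type*} (M : Matroid α) : Prop :=
  ∃ (r : ℕ) (A : Fin r → Set α), (∀ i, A i ⊆ M.E) ∧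
    ∀ I : Set α, M.Indep I ↔ ∃ f : I → Fin r, Function.Injective f ∧ ∀ x : I, (x : α) ∈ A (f x)

/-- `L` is a Tr-lattice: every (finite) matroid whose poset of cyclic flats is isomorphic to `L` is
transversal. -/
def IsTrLattice (L : Type v) [Lattice L] : Prop :=
  ∀ (α : Type u) (M : Matroid α), M.Finite → Nonempty (L ≃o M.CyclicFlats) → M.IsTransversal

/-- `a 0, a 1, …, a (t - 1)` is an MI-ordering of the set `S`. (The indices are shifted by one:
`a i` here is `a_{i+1}` in one-based notation.) -/
structure IsMIOrdering {L : Type*} [Lattice L] (S : Set L) {t : ℕ} (a : Fin t → L) : Prop where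
  injective : Function.Injective a
  range_eq : Set.range a = S
  sup_eq : ∀ (i k : Fin t) (hik : i < k),
    (Finset.Icc i k).sup' (Finset.nonempty_Icc.2 hik.le) a = a i ⊔ a k
  inf_sup_eq : ∀ (k : ℕ) (_ : 1 ≤ k) (hk : k + 1 < t),
    (Finset.Iic (⟨k, by omega⟩ : Fin t)).inf' Finset.nonempty_Iic a ⊔ a ⟨k + 1, hk⟩ =
      a ⟨k, by omega⟩ ⊔ a ⟨k + 1, hk⟩

/-- `L` is MI-orderable: each of its antichains has an MI-ordering. -/
def IsMIOrderable (L : Type*) [Lattice L] : Prop :=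
  ∀ S : Set L, IsAntichain (· ≤ ·) S → ∃ (t : ℕ) (a : Fin t → L), IsMIOrdering S a

/-- The lattice `D^d`, given by its nine elements, listed from bottom to top;
`LatticeDDual.covBy_iff` gives its Hasse diagram. -/
inductive LatticeDDual : Type
  | z | p | q | a | m | c | s | b | e
  deriving DecidableEq

namespace LatticeDDual

/-- The elements of the lattice, in an order that is a linear extension. -/
def elems : List LatticeDDual := [.z, .p, .q, .a, .m, .c, .s, .b, .e]

instance : Fintype LatticeDDual := ⟨elems.toFinset, fun x => by cases x <;> decide⟩

/-- The elements that lie weakly above a given one. -/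
def upper : LatticeDDual → List LatticeDDual
  | .z => elems
  | .p => [.p, .a, .m, .s, .b, .e]
  | .q => [.q, .m, .c, .s, .b, .e]
  | .a => [.a, .s, .e]
  | .m => [.m, .s, .b, .e]
  | .c => [.c, .s, .e]
  | .s => [.s, .e]
  | .b => [.b, .e]
  | .e => [.e]

/-- The first common upper bound of `x` and `y`, which is their join. -/
def join (x y : LatticeDDual) : LatticeDDual :=
  (elems.find? fun w => w ∈ upper x ∧ w ∈ upper y).getD .e

/-- The last common lower bound of `x` and `y`, which is their meet. -/
def meet (x y : LatticeDDual) : LatticeDDual :=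
  (elems.reverse.find? fun w => x ∈ upper w ∧ y ∈ upper w).getD .z

instance : Lattice LatticeDDual where
  le x y := y ∈ upper x
  le_refl := by decide +kernel
  le_trans := by decide +kernel
  le_antisymm := by decide +kernel
  sup := join
  inf := meet
  le_sup_left := by decide +kernel
  le_sup_right := by decide +kernel
  sup_le := by decide +kernel
  inf_le_left := by decide +kernel
  inf_le_right := by decide +kernel
  le_inf := by decide +kernel

instance : DecidableLE LatticeDDual := fun x y => inferInstanceAs (Decidable (y ∈ upper x))

/-- The Hasse diagram: the twelve covering pairs. -/
theorem covBy_iff (x y : LatticeDDual) : x ⋖ y ↔ (x, y) ∈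
    ([(.z, .p), (.z, .q), (.p, .a), (.p, .m), (.q, .m), (.q, .c),
       (.a, .s), (.m, .s), (.c, .s), (.m, .b), (.s, .e), (.b, .e)] :
      List (LatticeDDual × LatticeDDual)) := by
  have h : ∀ x y : LatticeDDual, ((x ≤ y ∧ ¬ y ≤ x) ∧ ∀ w, x ≤ w ∧ ¬ w ≤ x → ¬ (w ≤ y ∧ ¬ y ≤ w)) ↔
      (x, y) ∈ ([(.z, .p), (.z, .q), (.p, .a), (.p, .m), (.q, .m), (.q, .c),
       (.a, .s), (.m, .s), (.c, .s), (.m, .b), (.s, .e), (.b, .e)] :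
        List (LatticeDDual × LatticeDDual)) := by
    decide +kernel
  rw [← h, CovBy]
  simp only [lt_iff_le_not_ge]

end LatticeDDual

/-- The lattice `F_0`, given by its nine elements, listed from bottom to top;
`LatticeF0.covBy_iff` gives its Hasse diagram. -/
inductive LatticeF0 : Type
  | Z | D | U | T | X | A | S | R | E
  deriving DecidableEq

namespace LatticeF0

/-- The elements of the lattice, in an order that is a linear extension. -/
def elems : List LatticeF0 := [.Z, .D, .U, .T, .X, .A, .S, .R, .E]

instance : Fintype LatticeF0 := ⟨elems.toFinset, fun x => by cases x <;> decide⟩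

/-- The elements that lie weakly above a given one. -/
def upper : LatticeF0 → List LatticeF0
  | .Z => elems
  | .D => [.D, .S, .R, .E]
  | .U => [.U, .T, .X, .A, .S, .R, .E]
  | .T => [.T, .A, .S, .R, .E]
  | .X => [.X, .R, .E]
  | .A => [.A, .E]
  | .S => [.S, .R, .E]
  | .R => [.R, .E]
  | .E => [.E]

/-- The first common upper bound of `x` and `y`, which is their join. -/
def join (x y : LatticeF0) : LatticeF0 :=
  (elems.find? fun w => w ∈ upper x ∧ w ∈ upper y).getD .E

/-- The last common lower bound of `x` and `y`, which is their meet. -/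
def meet (x y : LatticeF0) : LatticeF0 :=
  (elems.reverse.find? fun w => x ∈ upper w ∧ y ∈ upper w).getD .Z

instance : Lattice LatticeF0 where
  le x y := y ∈ upper x
  le_refl := by decide +kernel
  le_trans := by decide +kernel
  le_antisymm := by decide +kernel
  sup := join
  inf := meet
  le_sup_left := by decide +kernel
  le_sup_right := by decide +kernel
  sup_le := by decide +kernel
  inf_le_left := by decide +kernel
  inf_le_right := by decide +kernel
  le_inf := by decide +kernel

instance : DecidableLE LatticeF0 := fun x y => inferInstanceAs (Decidable (y ∈ upper x))

/-- The Hasse diagram: the eleven covering pairs. -/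
theorem covBy_iff (x y : LatticeF0) : x ⋖ y ↔ (x, y) ∈
    ([(.Z, .D), (.Z, .U), (.U, .X), (.U, .T), (.T, .A), (.T, .S),
       (.D, .S), (.S, .R), (.X, .R), (.R, .E), (.A, .E)] :
      List (LatticeF0 × LatticeF0)) := by
  have h : ∀ x y : LatticeF0, ((x ≤ y ∧ ¬ y ≤ x) ∧ ∀ w, x ≤ w ∧ ¬ w ≤ x → ¬ (w ≤ y ∧ ¬ y ≤ w)) ↔
      (x, y) ∈ ([(.Z, .D), (.Z, .U), (.U, .X), (.U, .T), (.T, .A), (.T, .S),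
       (.D, .S), (.S, .R), (.X, .R), (.R, .E), (.A, .E)] :
        List (LatticeF0 × LatticeF0)) := by
    decide +kernel
  rw [← h, CovBy]
  simp only [lt_iff_le_not_ge]

end LatticeF0

/-- The lattice `C`, given by its nine elements, listed from bottom to top;
`LatticeC.covBy_iff` gives its Hasse diagram. -/
inductive LatticeC : Type
  | Z | T | Y | V | W | A | S | B | E
  deriving DecidableEq

namespace LatticeC

/-- The elements of the lattice, in an order that is a linear extension. -/
def elems : List LatticeC := [.Z, .T, .Y, .V, .W, .A, .S, .B, .E]

instance : Fintype LatticeC := ⟨elems.toFinset, fun x => by cases x <;> decide⟩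

/-- The elements that lie weakly above a given one. -/
def upper : LatticeC → List LatticeC
  | .Z => elems
  | .T => [.T, .V, .W, .A, .S, .B, .E]
  | .Y => [.Y, .S, .E]
  | .V => [.V, .A, .S, .E]
  | .W => [.W, .S, .B, .E]
  | .A => [.A, .E]
  | .S => [.S, .E]
  | .B => [.B, .E]
  | .E => [.E]

/-- The first common upper bound of `x` and `y`, which is their join. -/
def join (x y : LatticeC) : LatticeC :=
  (elems.find? fun w => w ∈ upper x ∧ w ∈ upper y).getD .E

/-- The last common lower bound of `x` and `y`, which is their meet. -/
def meet (x y : LatticeC) : LatticeC :=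
  (elems.reverse.find? fun w => x ∈ upper w ∧ y ∈ upper w).getD .Z

instance : Lattice LatticeC where
  le x y := y ∈ upper x
  le_refl := by decide +kernel
  le_trans := by decide +kernel
  le_antisymm := by decide +kernel
  sup := join
  inf := meet
  le_sup_left := by decide +kernel
  le_sup_right := by decide +kernel
  sup_le := by decide +kernel
  inf_le_left := by decide +kernel
  inf_le_right := by decide +kernel
  le_inf := by decide +kernel

instance : DecidableLE LatticeC := fun x y => inferInstanceAs (Decidable (y ∈ upper x))

/-- The Hasse diagram: the twelve covering pairs. -/
theorem covBy_iff (x y : LatticeC) : x ⋖ y ↔ (x, y) ∈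
    ([(.Z, .T), (.Z, .Y), (.T, .V), (.T, .W), (.V, .A), (.V, .S),
       (.W, .S), (.W, .B), (.Y, .S), (.A, .E), (.S, .E), (.B, .E)] :
      List (LatticeC × LatticeC)) := by
  have h : ∀ x y : LatticeC, ((x ≤ y ∧ ¬ y ≤ x) ∧ ∀ w, x ≤ w ∧ ¬ w ≤ x → ¬ (w ≤ y ∧ ¬ y ≤ w)) ↔
      (x, y) ∈ ([(.Z, .T), (.Z, .Y), (.T, .V), (.T, .W), (.V, .A), (.V, .S),
       (.W, .S), (.W, .B), (.Y, .S), (.A, .E), (.S, .E), (.B, .E)] :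
        List (LatticeC × LatticeC)) := by
    decide +kernel
  rw [← h, CovBy]
  simp only [lt_iff_le_not_ge]

end LatticeC

/-! For the Tr-lattices, define `β` by Möbius inversion so that its sum over the cyclic flats above
`φ x` is `r(M) - r(φ x)`. If `β ≥ 0`, the complements of the cyclic flats, repeated `β` times,
present `M` as soon as `r(T) + β(U) ≤ r(M)`, where `U` is the filter of cyclic flats containing `T`;
this is Hall's theorem (`Matroid.isTransversal_of_intRk_add_sum_le`). These Mason–Ingleton
inequalities follow from submodularity for any filter built up by `IsModularlyGenerated`, and they
also give `β ≥ 0`. So it is enough to build every nonempty filter of `F_0` and `C` in this way.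
Redundant generators are allowed, which makes this possible even for an antichain without an
MI-ordering. The statements on MI-orderability are finite checks on antichains with at most three
elements. -/

open Finset in
/-- The filter of a finite lattice generated by an element. -/
def principalFilter {L : Type*} [LE L] [Fintype L] [DecidableLE L] (x : L) : Finset L :=
  univ.filter (x ≤ ·)

@[simp]
theorem mem_principalFilter {L : Type*} [LE L] [Fintype L] [DecidableLE L] {x y : L} :
    y ∈ principalFilter x ↔ x ≤ y := by
  simp [principalFilter]

/-- The filters of a finite lattice that arise from principal filters by adding one generator `y`
at a time, where the new generator meets the old filter in a principal filter with generator
`m ⊔ y` for some lower bound `m` of the old filter. -/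
inductive IsModularlyGenerated {L : Type*} [Lattice L] [Fintype L] [DecidableEq L]
    [DecidableLE L] : Finset L → Prop
  | principal (x : L) : IsModularlyGenerated (principalFilter x)
  | step {U : Finset L} (hU : IsModularlyGenerated U) (y w m : L)
      (hw : U ∩ principalFilter y = principalFilter w) (hm : ∀ u ∈ U, m ≤ u) (hle : w ≤ m ⊔ y) :
      IsModularlyGenerated (U ∪ principalFilter y)

namespace IsModularlyGenerated

variable {L : Type*} [Lattice L] [Fintype L] [DecidableEq L] [DecidableLE L]

/-- With `m = x` the required inequality is an equality, so two generators never cause trouble. -/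
theorem pair (x y : L) : IsModularlyGenerated (principalFilter x ∪ principalFilter y) :=
  (principal x).step y (x ⊔ y) x (by ext; simp) (by simp) le_rfl

end IsModularlyGenerated

/-- Every function on a finite partial order is obtained by summing some function over upper
intervals. -/
theorem exists_sum_principalFilter_eq {L : Type*} [PartialOrder L] [Fintype L] [DecidableLE L]
    (f : L → ℤ) : ∃ β : L → ℤ, ∀ x, ∑ y ∈ principalFilter x, β y = f x := by
  classical
  have wf : WellFounded ((· > ·) : L → L → Prop) := wellFounded_gt
  let F : (x : L) → ((y : L) → y > x → ℤ) → ℤ :=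
    fun x g => f x - ∑ y : {y // y > x}, g y.1 y.2
  refine ⟨wf.fix F, fun x => ?_⟩
  have h1 : wf.fix F x = f x - ∑ y : {y // y > x}, wf.fix F y.1 := wf.fix_eq F x
  have h2 : principalFilter x = insert x (Finset.univ.filter (· > x)) := by
    ext y
    simp [le_iff_eq_or_lt, eq_comm]
  rw [h2, Finset.sum_insert (by simp), h1,
    ← Finset.sum_subtype (f := wf.fix F) (Finset.univ.filter (· > x)) (by simp)]
  ring

/-! ### Rank and the lattice of cyclic flats -/

namespace Matroid

variable {α : Type*} {M : Matroid α} {X Y : Set α}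

/-- The rank of a set, as an integer. -/
noncomputable def intRk (M : Matroid α) (X : Set α) : ℤ := (M.eRk X).toNat

theorem exists_eRk_eq_natCast [M.Finite] (X : Set α) :
    ∃ n : ℕ, M.eRk X = n ∧ M.intRk X = n :=
  ⟨(M.eRk X).toNat, (ENat.natCast_toNat (eRk_ne_top_iff.2 (M.isRkFinite_set X))).symm, rfl⟩

theorem intRk_mono [M.Finite] (h : X ⊆ Y) : M.intRk X ≤ M.intRk Y := by
  obtain ⟨m, hm, hm'⟩ := M.exists_eRk_eq_natCast X
  obtain ⟨n, hn, hn'⟩ := M.exists_eRk_eq_natCast Y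
  have := M.eRk_mono h
  rw [hm, hn] at this
  rw [hm', hn']
  exact_mod_cast this

theorem intRk_closure (M : Matroid α) (X : Set α) : M.intRk (M.closure X) = M.intRk X := by
  rw [intRk, eRk_closure_eq, intRk]

theorem intRk_inter_add_intRk_union_le (M : Matroid α) [M.Finite] (X Y : Set α) :
    M.intRk (X ∩ Y) + M.intRk (X ∪ Y) ≤ M.intRk X + M.intRk Y := by
  obtain ⟨k, hk, hk'⟩ := M.exists_eRk_eq_natCast (X ∩ Y)
  obtain ⟨l, hl, hl'⟩ := M.exists_eRk_eq_natCast (X ∪ Y)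
  obtain ⟨m, hm, hm'⟩ := M.exists_eRk_eq_natCast X
  obtain ⟨n, hn, hn'⟩ := M.exists_eRk_eq_natCast Y
  have := M.eRk_inter_add_eRk_union_le X Y
  rw [hk, hl, hm, hn] at this
  rw [hk', hl', hm', hn']
  exact_mod_cast this

theorem Indep.intRk_eq_card {I : Finset α} (hI : M.Indep I) : M.intRk I = I.card := by
  rw [intRk, hI.eRk_eq_encard, Set.encard_coe_eq_coe_finsetCard, ENat.toNat_natCast]

theorem IsCircuit.intRk_add_one_eq [M.Finite] {C : Finset α} (hC : M.IsCircuit C) :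
    M.intRk C + 1 = C.card := by
  obtain ⟨n, hn, hn'⟩ := M.exists_eRk_eq_natCast (C : Set α)
  have := hC.eRk_add_one_eq
  rw [hn, Set.encard_coe_eq_coe_finsetCard] at this
  rw [hn']
  exact_mod_cast this

theorem isCyclicFlat_iff :
    M.IsCyclicFlat X ↔ M.IsFlat X ∧ ∀ e ∈ X, e ∈ M.closure (X \ {e}) := by
  refine and_congr_right fun h => forall_congr' fun e => ?_
  rw [show M.restrict X = M ↾ X from rfl, restrict_isColoop_iff h.subset_ground]
  tauto

/-- A set with no coloops spans a cyclic flat. -/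
theorem isCyclicFlat_closure (hX : X ⊆ M.E) (h : ∀ e ∈ X, e ∈ M.closure (X \ {e})) :
    M.IsCyclicFlat (M.closure X) := by
  refine isCyclicFlat_iff.2 ⟨M.isFlat_closure X, fun e he => ?_⟩
  have hs := M.subset_closure X
  by_cases heX : e ∈ X
  · exact M.closure_subset_closure (Set.sdiff_subset_sdiff_left hs) (h e heX)
  · exact M.closure_subset_closure (Set.subset_sdiff_singleton hs heX) he

theorem IsCyclicFlat.closure_union (hX : M.IsCyclicFlat X) (hY : M.IsCyclicFlat Y) :
    M.IsCyclicFlat (M.closure (X ∪ Y)) := by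
  rw [isCyclicFlat_iff] at hX hY
  refine isCyclicFlat_closure (Set.union_subset hX.1.subset_ground hY.1.subset_ground) ?_
  rintro e (he | he)
  · exact M.closure_subset_closure (Set.sdiff_subset_sdiff_left Set.subset_union_left) (hX.2 e he)
  · exact M.closure_subset_closure (Set.sdiff_subset_sdiff_left Set.subset_union_right) (hY.2 e he)

theorem IsCircuit.isCyclicFlat_closure {C : Set α} (hC : M.IsCircuit C) :
    M.IsCyclicFlat (M.closure C) :=
  Matroid.isCyclicFlat_closure hC.subset_ground fun _ he => hC.mem_closure_sdiff_singleton_of_mem he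

theorem isCyclicFlat_closure_empty (M : Matroid α) : M.IsCyclicFlat (M.closure ∅) :=
  Matroid.isCyclicFlat_closure (Set.empty_subset _) (by simp)

theorem intRk_closure_empty (M : Matroid α) : M.intRk (M.closure ∅) = 0 := by
  simp [intRk]

section Lattice

variable {L : Type*} [Lattice L] (φ : L ≃o M.CyclicFlats)

theorem orderIso_subset_iff {x y : L} : (φ x : Set α) ⊆ φ y ↔ x ≤ y :=
  φ.le_iff_le

/-- The closure of the union of two cyclic flats is a cyclic flat, hence the image of an upper bound
of `x` and `y`. This turns joins in `L` into rank bounds in `M`. -/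
theorem orderIso_sup_subset_closure (x y : L) :
    (φ (x ⊔ y) : Set α) ⊆ M.closure (φ x ∪ φ y) := by
  let Z : M.CyclicFlats := ⟨_, (φ x).2.closure_union (φ y).2⟩
  have hs : (φ x : Set α) ∪ φ y ⊆ M.closure (φ x ∪ φ y) :=
    M.subset_closure _ (Set.union_subset (φ x).2.1.subset_ground (φ y).2.1.subset_ground)
  have h : x ⊔ y ≤ φ.symm Z :=
    sup_le ((OrderIso.le_symm_apply φ).2 (Set.subset_union_left.trans hs))
      ((OrderIso.le_symm_apply φ).2 (Set.subset_union_right.trans hs))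
  exact (OrderIso.le_symm_apply φ).1 h

end Lattice

end Matroid

/-! ### Mason–Ingleton inequalities and transversality -/

namespace Matroid

variable {α : Type*} {M : Matroid α} {L : Type*} [Lattice L] [Fintype L]

section Filters

variable [DecidableEq L] [DecidableLE L]

/-- The Mason–Ingleton inequality for a modularly generated filter. -/
theorem intRk_add_sum_le_of_isModularlyGenerated [M.Finite] (φ : L ≃o M.CyclicFlats) {β : L → ℤ}
    (hβ : ∀ x, ∑ y ∈ principalFilter x, β y = M.intRk M.E - M.intRk (φ x)) {U : Finset L}
    (hU : IsModularlyGenerated U) (T : Set α) (hTE : T ⊆ M.E)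
    (hT : ∀ y ∈ U, T ⊆ φ y) : M.intRk T + ∑ y ∈ U, β y ≤ M.intRk M.E := by
  induction hU generalizing T with
  | principal x =>
    have := intRk_mono (M := M) (hT x (by simp))
    rw [hβ]
    linarith
  | @step U hU y w m hw hm hle ih =>
    -- The induction hypothesis is used for the whole intersection `T₀`, not for `T`: it contains `φ
    -- m`, so `w ≤ m ⊔ y` places `φ w` in the closure of `T₀ ∪ φ y`. Submodularity on `T₀` and `φ y`
    -- then finishes.
    let T₀ : Set α := M.E ∩ ⋂ u ∈ U, φ u
    have h₀ := ih T₀ Set.inter_subset_left fun u hu =>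
      Set.inter_subset_right.trans (Set.biInter_subset_of_mem hu)
    have hsum := Finset.sum_union_inter (s₁ := U) (s₂ := principalFilter y) (f := β)
    rw [hw, hβ, hβ] at hsum
    have hTi : T ⊆ T₀ ∩ φ y := Set.subset_inter
      (Set.subset_inter hTE (Set.subset_iInter₂ fun u hu => hT u (by simp [hu])))
      (hT y (by simp))
    have hmT : (φ m : Set α) ⊆ T₀ := Set.subset_inter (φ m).2.1.subset_ground
      (Set.subset_iInter₂ fun u hu => (orderIso_subset_iff φ).2 (hm u hu))
    have hwT : (φ w : Set α) ⊆ M.closure (T₀ ∪ φ y) :=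
      (((orderIso_subset_iff φ).2 hle).trans (orderIso_sup_subset_closure φ m y)).trans
        (M.closure_subset_closure (Set.union_subset_union_left _ hmT))
    have h1 := intRk_mono (M := M) hTi
    have h2 := M.intRk_inter_add_intRk_union_le T₀ (φ y)
    have h3 := intRk_mono (M := M) hwT
    rw [intRk_closure] at h3
    linarith

end Filters

open Classical in
/-- If the multiplicities `β` satisfy the Mason–Ingleton inequalities, then the complements of the
cyclic flats, repeated according to `β`, present the matroid. -/
theorem isTransversal_of_intRk_add_sum_le [M.Finite] (φ : L ≃o M.CyclicFlats) {β : L → ℕ}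
    (hβ : ∀ x, ∑ y ∈ principalFilter x, (β y : ℤ) = M.intRk M.E - M.intRk (φ x))
    (hle : ∀ T ⊆ M.E,
      M.intRk T + ∑ y with T ⊆ (φ y : Set α), (β y : ℤ) ≤ M.intRk M.E) :
    M.IsTransversal := by
  let J := Σ x : L, Fin (β x)
  let A : J → Set α := fun j => M.E \ φ j.1
  have hcard : ∀ p : L → Prop, ((Finset.univ.filter fun j : J => p j.1).card : ℤ) =
      ∑ y with p y, (β y : ℤ) := by
    intro p
    have : (Finset.univ.filter fun j : J => p j.1) =
        (Finset.univ.filter p).sigma fun _ => Finset.univ := by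
      ext j
      rw [Finset.mem_sigma]
      simp
    rw [this, Finset.card_sigma]
    simp
  -- The closure of `∅` is the least cyclic flat and has rank 0, so the filter above it is all of
  -- `L`.
  have htotal : ∑ y, (β y : ℤ) = M.intRk M.E := by
    let x₀ : L := φ.symm ⟨_, M.isCyclicFlat_closure_empty⟩
    have h := hβ x₀
    have hx₀ : (φ x₀ : Set α) = M.closure ∅ := by simp [x₀]
    have hmin : ∀ y, x₀ ≤ y := fun y => by
      rw [← orderIso_subset_iff φ, hx₀, ← (φ y).2.1.closure]
      exact M.closure_subset_closure (Set.empty_subset _)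
    rw [hx₀, intRk_closure_empty, sub_zero, principalFilter,
      Finset.filter_true_of_mem fun y _ => hmin y] at h
    exact h
  have hmeet : ∀ T ⊆ M.E, ((Finset.univ.filter fun j : J => ∃ a ∈ T, a ∈ A j).card : ℤ) =
      M.intRk M.E - ∑ y with T ⊆ (φ y : Set α), (β y : ℤ) := by
    intro T hT
    have h1 : ∀ j : J, (∃ a ∈ T, a ∈ A j) ↔ ¬ T ⊆ (φ j.1 : Set α) := fun j => by
      rw [Set.not_subset]
      exact exists_congr fun a => and_congr_right fun ha => and_iff_right (hT ha)
    have h2 : ((Finset.univ.filter fun j : J => ∃ a ∈ T, a ∈ A j).card : ℤ) =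
        ∑ y with ¬ T ⊆ (φ y : Set α), (β y : ℤ) := by
      convert hcard fun y => ¬ T ⊆ (φ y : Set α) using 3
      ext j
      simp only [Finset.mem_filter, h1]
    rw [h2, ← htotal,
      ← Finset.sum_filter_add_sum_filter_not Finset.univ (fun y => T ⊆ (φ y : Set α))]
    ring
  have key : ∀ I : Set α,
      M.Indep I ↔ ∃ f : I → J, Function.Injective f ∧ ∀ x : I, (x : α) ∈ A (f x) := by
    intro I
    constructor
    · intro hI
      -- Hall's condition for a subset of `I` is `hle` for that subset, whose rank is its size.
      refine (Fintype.all_card_le_filter_rel_iff_exists_injective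
        fun (x : I) (j : J) => (x : α) ∈ A j).1 fun S => ?_
      have hS : M.Indep (S.map (Function.Embedding.subtype _) : Finset α) :=
        hI.subset (by simp)
      have h1 := hmeet _ hS.subset_ground
      have h2 := hle _ hS.subset_ground
      rw [hS.intRk_eq_card, Finset.card_map] at h2
      have h3 : (S.card : ℤ) ≤ M.intRk M.E - _ := le_sub_iff_add_le.2 h2
      rw [← h1] at h3
      exact (Nat.cast_le.1 h3).trans (Finset.card_le_card fun j hj => by simpa using hj)
    · rintro ⟨f, hf, hfA⟩
      by_contra hI
      have hIE : I ⊆ M.E := fun x hx => (hfA ⟨x, hx⟩).1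
      obtain ⟨C', hCI, hC⟩ := Dep.exists_isCircuit_subset ⟨hI, hIE⟩
      obtain ⟨C, rfl⟩ := (M.ground_finite.subset hC.subset_ground).exists_finset_coe
      have h1 := hmeet (C : Set α) hC.subset_ground
      let z : L := φ.symm ⟨_, hC.isCyclicFlat_closure⟩
      have hz : (φ z : Set α) = M.closure C := by simp [z]
      -- The cyclic flats containing the circuit `C` are those above its closure, so `C` meets
      -- exactly `r(C) = |C| - 1` of the sets and cannot be matched.
      have h2 : (Finset.univ.filter fun y => (C : Set α) ⊆ (φ y : Set α)) = principalFilter z := by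
        ext y
        rw [mem_principalFilter, ← orderIso_subset_iff φ, hz, Finset.mem_filter,
          and_iff_right (Finset.mem_univ _)]
        exact ⟨fun h => (φ y).2.1.closure ▸ M.closure_subset_closure h,
          (M.subset_closure _ hC.subset_ground).trans⟩
      rw [h2, hβ, hz, intRk_closure] at h1
      have h3 := hC.intRk_add_one_eq
      have h4 : (C.card : ℤ) ≤ M.intRk M.E - (M.intRk M.E - M.intRk C) := by
        rw [← h1, Nat.cast_le, ← Finset.card_attach]
        refine Finset.card_le_card_of_injOn (fun a => f ⟨a.1, hCI a.2⟩) ?_ ?_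
        · intro a _
          simpa using ⟨a.1, a.2, hfA ⟨a.1, hCI a.2⟩⟩
        · intro a _ b _ hab
          exact Subtype.ext (congrArg Subtype.val (hf hab) :)
      linarith
  let e := Fintype.equivFin J
  refine ⟨Fintype.card J, fun i => A (e.symm i), fun i => Set.sdiff_subset, fun I => ?_⟩
  rw [key]
  constructor
  · rintro ⟨f, hf, hfA⟩
    exact ⟨e ∘ f, e.injective.comp hf, fun x => by simpa using hfA x⟩
  · rintro ⟨f, hf, hfA⟩
    exact ⟨e.symm ∘ f, e.symm.injective.comp hf, hfA⟩

end Matroid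

/-- A finite lattice all of whose nonempty filters are modularly generated is a Tr-lattice. -/
theorem isTrLattice_of_isModularlyGenerated {L : Type v} [Lattice L] [Fintype L] [DecidableEq L]
    [DecidableLE L]
    (h : ∀ U : Finset L, U.Nonempty → (∀ x ∈ U, ∀ y, x ≤ y → y ∈ U) → IsModularlyGenerated U) :
    IsTrLattice.{u, v} L := by
  classical
  rintro α M hM ⟨φ⟩
  obtain ⟨β, hβ⟩ := exists_sum_principalFilter_eq fun x => M.intRk M.E - M.intRk (φ x)
  have hle : ∀ (U : Finset L) (T : Set α), (∀ x ∈ U, ∀ y, x ≤ y → y ∈ U) → T ⊆ M.E →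
      (∀ y ∈ U, T ⊆ φ y) → M.intRk T + ∑ y ∈ U, β y ≤ M.intRk M.E := by
    intro U T hU hTE hT
    rcases U.eq_empty_or_nonempty with rfl | hne
    · simpa using Matroid.intRk_mono hTE
    · exact Matroid.intRk_add_sum_le_of_isModularlyGenerated φ hβ (h U hne hU) T hTE hT
  have hnonneg : ∀ x, 0 ≤ β x := by
    intro x
    -- The inequality for the filter strictly above `x`, with `T = φ x`, says precisely that `β x ≥
    -- 0`.
    have h1 := hle (Finset.univ.filter (x < ·)) (φ x)
      (fun a ha b hab => by simpa using (Finset.mem_filter.1 ha).2.trans_le hab)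
      (φ x).2.1.subset_ground
      (fun y hy => (Matroid.orderIso_subset_iff φ).2 (Finset.mem_filter.1 hy).2.le)
    have h2 : principalFilter x = insert x (Finset.univ.filter (x < ·)) := by
      ext y
      simp [le_iff_eq_or_lt, eq_comm]
    have h3 := hβ x
    rw [h2, Finset.sum_insert (by simp)] at h3
    linarith
  have hcast : ∀ x, ((β x).toNat : ℤ) = β x := fun x => Int.toNat_of_nonneg (hnonneg x)
  refine Matroid.isTransversal_of_intRk_add_sum_le φ (β := fun x => (β x).toNat) ?_ ?_
  · intro x
    simp_rw [hcast]
    convert hβ x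
  · intro T hTE
    simp_rw [hcast]
    refine hle _ T (fun x hx y hxy => ?_) hTE fun y hy => (Finset.mem_filter.1 hy).2
    simp only [Finset.mem_filter, Finset.mem_univ, true_and] at hx ⊢
    exact hx.trans ((Matroid.orderIso_subset_iff φ).2 hxy)

/-! ### Filters of `F_0` and `C` -/

namespace LatticeF0

theorem filter_cases : ∀ U : Finset LatticeF0, U.Nonempty → (∀ x ∈ U, ∀ y, x ≤ y → y ∈ U) →
    (∃ x, U = principalFilter x) ∨ (∃ x y, U = principalFilter x ∪ principalFilter y) ∨
    U = principalFilter T ∪ principalFilter X ∪ principalFilter D ∨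
    U = principalFilter A ∪ principalFilter S ∪ principalFilter X ∨
    U = principalFilter A ∪ principalFilter S ∪ principalFilter X ∪ principalFilter D := by
  decide +kernel

theorem isModularlyGenerated (U : Finset LatticeF0) (hne : U.Nonempty)
    (hU : ∀ x ∈ U, ∀ y, x ≤ y → y ∈ U) : IsModularlyGenerated U := by
  have hTXD : IsModularlyGenerated
      (principalFilter T ∪ principalFilter X ∪ principalFilter D) :=
    (IsModularlyGenerated.pair T X).step D S .U
      (by decide +kernel) (by decide +kernel) (by decide +kernel)
  have hASX : IsModularlyGenerated
      (principalFilter A ∪ principalFilter S ∪ principalFilter X) :=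
    (IsModularlyGenerated.pair A S).step X R T
      (by decide +kernel) (by decide +kernel) (by decide +kernel)
  -- This is the filter of the antichain `{D, A, X}`. The redundant generator `S` is what helps: `D`
  -- now meets the old filter in the filter of `S = U ⊔ D`. Without `S` it would meet it in the
  -- filter of `R`, which is not below `U ⊔ D`.
  have hASXD := hASX.step D S .U (by decide +kernel) (by decide +kernel) (by decide +kernel)
  rcases filter_cases U hne hU with ⟨x, rfl⟩ | ⟨x, y, rfl⟩ | rfl | rfl | rfl
  exacts [.principal x, .pair x y, hTXD, hASX, hASXD]

theorem isTrLattice : IsTrLattice.{u, 0} LatticeF0 :=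
  isTrLattice_of_isModularlyGenerated isModularlyGenerated

end LatticeF0

namespace LatticeC

theorem filter_cases : ∀ U : Finset LatticeC, U.Nonempty → (∀ x ∈ U, ∀ y, x ≤ y → y ∈ U) →
    (∃ x, U = principalFilter x) ∨ (∃ x y, U = principalFilter x ∪ principalFilter y) ∨
    U = principalFilter V ∪ principalFilter W ∪ principalFilter Y ∨
    U = principalFilter V ∪ principalFilter B ∪ principalFilter Y ∨
    U = principalFilter A ∪ principalFilter W ∪ principalFilter Y ∨
    U = principalFilter A ∪ principalFilter S ∪ principalFilter B ∨
    U = principalFilter A ∪ principalFilter S ∪ principalFilter B ∪ principalFilter Y := by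
  decide +kernel

theorem isModularlyGenerated (U : Finset LatticeC) (hne : U.Nonempty)
    (hU : ∀ x ∈ U, ∀ y, x ≤ y → y ∈ U) : IsModularlyGenerated U := by
  have hVWY := (IsModularlyGenerated.pair V W).step Y S T
    (by decide +kernel) (by decide +kernel) (by decide +kernel)
  have hVBY := (IsModularlyGenerated.pair V B).step Y S T
    (by decide +kernel) (by decide +kernel) (by decide +kernel)
  have hAWY := (IsModularlyGenerated.pair A W).step Y S T
    (by decide +kernel) (by decide +kernel) (by decide +kernel)
  have hASB := (IsModularlyGenerated.pair A S).step B E V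
    (by decide +kernel) (by decide +kernel) (by decide +kernel)
  -- This is the filter of `{A, B, Y}`; again `S`, redundant since `Y ≤ S`, makes the new
  -- intersection the filter of `S = T ⊔ Y` instead of that of `E`.
  have hASBY := hASB.step Y S T
    (by decide +kernel) (by decide +kernel) (by decide +kernel)
  rcases filter_cases U hne hU with ⟨x, rfl⟩ | ⟨x, y, rfl⟩ | rfl | rfl | rfl | rfl | rfl
  exacts [.principal x, .pair x y, hVWY, hVBY, hAWY, hASB, hASBY]

theorem isTrLattice : IsTrLattice.{u, 0} LatticeC :=
  isTrLattice_of_isModularlyGenerated isModularlyGenerated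

end LatticeC

/-! ### MI-orderings of small antichains -/

section MIOrdering

variable {L : Type*} [Lattice L]

theorem isMIOrdering_of_le_two {S : Set L} {t : ℕ} {a : Fin t → L} (ht : t ≤ 2)
    (hinj : Function.Injective a) (hrange : Set.range a = S) : IsMIOrdering S a where
  injective := hinj
  range_eq := hrange
  sup_eq i k hik := by
    have h : Finset.Icc i k = {i, k} := by
      ext j
      simp only [Finset.mem_Icc, Finset.mem_insert, Finset.mem_singleton]
      omega
    simp [h]
  inf_sup_eq k h1 hk := by omega

/-- Condition (i) is trivial for adjacent indices, and (ii) has only one instance when `t = 3`. -/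
theorem isMIOrdering_three_iff {S : Set L} {a : Fin 3 → L} :
    IsMIOrdering S a ↔ Function.Injective a ∧ Set.range a = S ∧
      a 0 ⊔ a 1 ⊔ a 2 = a 0 ⊔ a 2 ∧ a 0 ⊓ a 1 ⊔ a 2 = a 1 ⊔ a 2 := by
  have h02 : Finset.Icc (0 : Fin 3) 2 = {0, 1, 2} := by decide
  have h01 : Finset.Icc (0 : Fin 3) 1 = {0, 1} := by decide
  have h12 : Finset.Icc (1 : Fin 3) 2 = {1, 2} := by decide
  have h1 : Finset.Iic (1 : Fin 3) = {0, 1} := by decide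
  constructor
  · intro h
    have hs := h.sup_eq 0 2 (by decide)
    have hi := h.inf_sup_eq 1 le_rfl (by decide)
    change (Finset.Iic (1 : Fin 3)).inf' _ a ⊔ a 2 = a 1 ⊔ a 2 at hi
    simp only [h02, h1, Finset.sup'_insert, Finset.inf'_insert, Finset.sup'_singleton,
      Finset.inf'_singleton, Finset.singleton_nonempty, Finset.insert_nonempty] at hs hi
    exact ⟨h.injective, h.range_eq, by rwa [sup_assoc], hi⟩
  · rintro ⟨hinj, hrange, hs, hi⟩
    refine ⟨hinj, hrange, fun i k hik => ?_, fun k hk1 hk => ?_⟩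
    · have : (i = 0 ∧ k = 1) ∨ (i = 1 ∧ k = 2) ∨ (i = 0 ∧ k = 2) := by omega
      rcases this with ⟨rfl, rfl⟩ | ⟨rfl, rfl⟩ | ⟨rfl, rfl⟩
      · simp [h01]
      · simp [h12]
      · simpa [h02, sup_assoc] using hs
    · obtain rfl : k = 1 := by omega
      change (Finset.Iic (1 : Fin 3)).inf' _ a ⊔ a 2 = a 1 ⊔ a 2
      simpa [h1] using hi

theorem isMIOrdering_three {x y w : L} (hxy : x ≠ y) (hxw : x ≠ w) (hyw : y ≠ w)
    (hs : x ⊔ y ⊔ w = x ⊔ w) (hi : x ⊓ y ⊔ w = y ⊔ w) :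
    IsMIOrdering {x, y, w} ![x, y, w] := by
  refine isMIOrdering_three_iff.2 ⟨?_, ?_, hs, hi⟩
  · intro i j
    fin_cases i <;> fin_cases j <;> simp [hxy, hxw, hyw, hxy.symm, hxw.symm, hyw.symm]
  · ext u
    simp [eq_comm]
    tauto

/-- An antichain `{x, y, w}` without MI-ordering obstructs MI-orderability. -/
theorem not_isMIOrderable_of_card_eq_three [DecidableEq L] (S : Finset L) (hcard : S.card = 3)
    (hS : IsAntichain (· ≤ ·) (S : Set L))
    (h : ∀ x ∈ S, ∀ y ∈ S, ∀ w ∈ S, x ≠ y → x ≠ w → y ≠ w → x ⊓ y ⊔ w ≠ y ⊔ w) :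
    ¬ IsMIOrderable L := by
  intro hL
  obtain ⟨t, a, ha⟩ := hL S hS
  obtain rfl : t = 3 := by
    rw [← hcard, ← Set.ncard_coe_finset, ← ha.range_eq, ← Set.image_univ,
      Set.ncard_image_of_injective _ ha.injective, Set.ncard_univ, Nat.card_fin]
  have hmem : ∀ i, a i ∈ S := fun i => by
    rw [← Finset.mem_coe, ← ha.range_eq]
    exact Set.mem_range_self i
  have hne : ∀ i j, i ≠ j → a i ≠ a j := fun i j => ha.injective.ne
  exact h _ (hmem 0) _ (hmem 1) _ (hmem 2) (hne _ _ (by decide)) (hne _ _ (by decide))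
    (hne _ _ (by decide)) (isMIOrdering_three_iff.1 ha).2.2.2

end MIOrdering

/-- The three-element antichains are `{a, m, c}`, ordered `a, m, c`, and `{a, b, c}`, ordered `b, a,
c`. -/
theorem LatticeDDual.antichain_cases : ∀ S : Finset LatticeDDual,
    (∀ x ∈ S, ∀ y ∈ S, x ≤ y → x = y) →
    S = ∅ ∨ (∃ x, S = {x}) ∨ (∃ x y, x ≠ y ∧ S = {x, y}) ∨
    ∃ x y w, (x ≠ y ∧ x ≠ w ∧ y ≠ w) ∧ (x ⊔ y ⊔ w = x ⊔ w ∧ x ⊓ y ⊔ w = y ⊔ w) ∧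
      S = {x, y, w} := by
  decide +kernel

theorem LatticeDDual.isMIOrderable : IsMIOrderable LatticeDDual := by
  intro S hS
  obtain ⟨S, rfl⟩ := S.toFinite.exists_finset_coe
  rcases LatticeDDual.antichain_cases S fun x hx y hy hxy => hS.eq hx hy hxy with
    rfl | ⟨x, rfl⟩ | ⟨x, y, hxy, rfl⟩ | ⟨x, y, w, ⟨hxy, hxw, hyw⟩, ⟨hs, hi⟩, rfl⟩
  · exact ⟨0, ![], isMIOrdering_of_le_two (by simp) (Function.injective_of_subsingleton _)
      (by simp)⟩
  · exact ⟨1, ![x], isMIOrdering_of_le_two (by simp) (Function.injective_of_subsingleton _)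
      (by simp)⟩
  · refine ⟨2, ![x, y], isMIOrdering_of_le_two le_rfl ?_ (by simp [Set.pair_comm])⟩
    intro i j
    fin_cases i <;> fin_cases j <;> simp [hxy, hxy.symm]
  · exact ⟨3, ![x, y, w], by simpa using isMIOrdering_three hxy hxw hyw hs hi⟩

/-- Condition (ii) fails in every order: `D` meets `A` and `X` in `Z`, so `D` would have to come
last, but `(A ⊓ X) ⊔ D = S` while `A ⊔ D = E` and `X ⊔ D = R`. -/
theorem LatticeF0.not_isMIOrderable : ¬ IsMIOrderable LatticeF0 := by
  refine not_isMIOrderable_of_card_eq_three {D, A, X} rfl ?_ (by decide +kernel)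
  have h : ∀ x ∈ ({D, A, X} : Finset LatticeF0), ∀ y ∈ ({D, A, X} : Finset LatticeF0),
      x ≠ y → ¬ x ≤ y := by
    decide +kernel
  exact fun x hx y hy hxy => h x hx y hy hxy

/-- Likewise `Y` would have to come last, but `(A ⊓ B) ⊔ Y = S` while `A ⊔ Y = B ⊔ Y = E`. -/
theorem LatticeC.not_isMIOrderable : ¬ IsMIOrderable LatticeC := by
  refine not_isMIOrderable_of_card_eq_three {A, B, Y} rfl ?_ (by decide +kernel)
  have h : ∀ x ∈ ({A, B, Y} : Finset LatticeC), ∀ y ∈ ({A, B, Y} : Finset LatticeC),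
      x ≠ y → ¬ x ≤ y := by
    decide +kernel
  exact fun x hx y hy hxy => h x hx y hy hxy

theorem mainTheorem7 :
    IsMIOrderable LatticeDDual ∧
    (IsTrLattice.{u, 0} LatticeF0 ∧ ¬ IsMIOrderable LatticeF0) ∧
    (IsTrLattice.{u, 0} LatticeC ∧ ¬ IsMIOrderable LatticeC) :=
  ⟨LatticeDDual.isMIOrderable, ⟨LatticeF0.isTrLattice, LatticeF0.not_isMIOrderable⟩,
    ⟨LatticeC.isTrLattice, LatticeC.not_isMIOrderable⟩⟩
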